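/- **Berezin–Lieb inequalities for entropy.** Let $d\in\mathbb N$. For $z=(x,\omega)\in\mathbb R^{2d}$ let $\pi(z)$ be the time-frequency shift $\pi(z)f(t)=e^{2\pi i t\cdot\omega}f(t-x)$ on $L^2(\mathbb R^d)$. For an operator $S$ on $L^2(\mathbb R^d)$ put $\alpha_z(S)=\pi(z)S\pi(z)^*$ and $\check S=PSP$, where $Pf(x)=f(-x)$. For $f\in L^1(\mathbb R^{2d})$ and trace class operators $S,T$ define the operator $f\star S=\int_{\mathbb R^{2d}}f(z)\,\alpha_z(S)\,dz$ and the function $S\star T(z)=\operatorname{tr}(S\,\alpha_z(\check T))$, and let $\tilde S=S\star\check S$; $\ast$ denotes the usual convolution of functions on $\mathbb R^{2d}$. For a positive trace class operator $A$ with $\operatorname{tr}A=1$ let $H_{vN}(A)=-\operatorname{tr}(A\log A)\in[0,\infty]$ be its von Neumann entropy, and for a probability density $f$ on $\mathbb R^{2d}$ let $H(f)=-\int_{\mathbb R^{2d}} f(z)\log f(z)\,dz$ be its differential entropy (extended-real valued), with the convention $0\log 0=0$. Let $S$ be a positive trace class operator on $L^2(\mathbb R^d)$ with $\operatorname{tr}(S)=1$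 (for example a data operator $S=\sum_{i=1}^N f_i\otimes f_i$ with $\sum_{i=1}^N\|f_i\|_2^2=1$). Then for every compact set $\Omega\subset\mathbb R^{2d}$ with Lebesgue measure $|\Omega|>0$, $$H\Big(\frac{\chi_\Omega}{|\Omega|}\ast\tilde S\Big)\;\ge\;H_{vN}\Big(\frac{\chi_\Omega}{|\Omega|}\star S\Big)\;\ge\;\log|\Omega| .$$ Moreover, $$H(\tilde S)\ge H_{vN}(S).$$ The inequalities are understood in the extended reals; the entropies may be $+\infty$. -/

import Mathlib

open MeasureTheory
open scoped ENNReal InnerProductSpace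

namespace QHA

noncomputable section

section Trace

theorem ofReal_norm_sq_eq_tsum {H : Type*} [NormedAddCommGroup H] [InnerProductSpace ℂ H]
    {ι : Type*} (b : HilbertBasis ι ℂ H) (x : H) :
    ENNReal.ofReal (‖x‖ ^ 2) = ∑' i, ENNReal.ofReal (‖⟪b i, x⟫_ℂ‖ ^ 2) := by
  have h := (b.hasSum_inner_mul_inner x x).mapL Complex.reCLM
  have h' : HasSum (fun i => ‖⟪b i, x⟫_ℂ‖ ^ 2) (‖x‖ ^ 2) := by
    convert h using 1
    · funext i
      rw [← inner_conj_symm x (b i), mul_comm, Complex.mul_conj, Complex.normSq_eq_norm_sq]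
      exact (Complex.ofReal_re _).symm
    · rw [inner_self_eq_norm_sq_to_K]
      simp [← Complex.ofReal_pow]
  rw [← h'.tsum_eq, ENNReal.ofReal_tsum_of_nonneg (fun i => by positivity) h'.summable]

variable (H : Type*) [NormedAddCommGroup H] [InnerProductSpace ℂ H] [CompleteSpace H]

/-- The index set of a fixed orthonormal basis of the Hilbert space `H`. -/
def basisIndex : Set H := (exists_hilbertBasis ℂ H).choose

/-- A fixed orthonormal (Hilbert) basis of `H`, used to compute traces. -/
def basis : HilbertBasis (basisIndex H) ℂ H := (exists_hilbertBasis ℂ H).choose_spec.choose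

variable {H}

/-- The trace `∑ ⟨T eᵢ, eᵢ⟩` of a trace class operator. -/
def trace (T : H →L[ℂ] H) : ℂ := ∑' i, ⟪basis H i, T (basis H i)⟫_ℂ

/-- The trace, with values in `[0, ∞]`, of a positive bounded operator. A positive operator is
trace class exactly when this is finite. -/
def posTrace (T : H →L[ℂ] H) : ℝ≥0∞ :=
  ∑' i, ENNReal.ofReal (⟪basis H i, T (basis H i)⟫_ℂ).re

/-- The trace of a positive operator can be computed in every orthonormal basis. -/
theorem posTrace_eq_of_hilbertBasis {ι : Type*} (b : HilbertBasis ι ℂ H) {T : H →L[ℂ] H}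
    (hT : T.IsPositive) :
    posTrace T = ∑' i, ENNReal.ofReal (⟪b i, T (b i)⟫_ℂ).re := by
  have hT0 : 0 ≤ T := (ContinuousLinearMap.nonneg_iff_isPositive T).2 hT
  have hR : (CFC.sqrt T).IsPositive :=
    (ContinuousLinearMap.nonneg_iff_isPositive _).1 (CFC.sqrt_nonneg T)
  have hsymm : ∀ x y, ⟪CFC.sqrt T x, y⟫_ℂ = ⟪x, CFC.sqrt T y⟫_ℂ := fun x y =>
    hR.isSymmetric x y
  have key : ∀ x, (⟪x, T x⟫_ℂ).re = ‖CFC.sqrt T x‖ ^ 2 := fun x => by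
    have : T x = CFC.sqrt T (CFC.sqrt T x) := by
      rw [← mul_apply_eq_comp, CFC.sqrt_mul_sqrt_self T hT0]
    rw [this, ← hsymm, inner_self_eq_norm_sq_to_K]
    simp [← Complex.ofReal_pow]
  simp only [posTrace, key]
  calc ∑' i, ENNReal.ofReal (‖CFC.sqrt T (basis H i)‖ ^ 2)
      = ∑' i, ∑' j, ENNReal.ofReal (‖⟪b j, CFC.sqrt T (basis H i)⟫_ℂ‖ ^ 2) := by
        simp only [ofReal_norm_sq_eq_tsum b]
    _ = ∑' j, ∑' i, ENNReal.ofReal (‖⟪b j, CFC.sqrt T (basis H i)⟫_ℂ‖ ^ 2) := ENNReal.tsum_comm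
    _ = ∑' j, ∑' i, ENNReal.ofReal (‖⟪basis H i, CFC.sqrt T (b j)⟫_ℂ‖ ^ 2) := by
        simp only [← hsymm, norm_inner_symm]
    _ = ∑' j, ENNReal.ofReal (‖CFC.sqrt T (b j)‖ ^ 2) := by
        simp only [ofReal_norm_sq_eq_tsum (basis H)]

/-- A density operator: a positive trace class operator with trace `1`. -/
def IsDensityOperator (S : H →L[ℂ] H) : Prop := S.IsPositive ∧ posTrace S = 1

/-- The von Neumann entropy `-tr (S log S)` of a density operator, with values in `[0, ∞]`.
The operator `-S log S` is the continuous functional calculus of `S` for `x ↦ -x log x`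
(with value `0` at `0`); it is positive as the spectrum of a density operator is in `[0, 1]`. -/
def vonNeumannEntropy (S : H →L[ℂ] H) : ℝ≥0∞ := posTrace (cfc Real.negMulLog S)

end Trace

/-- The differential entropy `-∫ f log f` of a probability density `f`, as the integral of the
positive part of `-f log f` minus the integral of its negative part. -/
def differentialEntropy {X : Type*} [MeasureSpace X] (f : X → ℝ) : EReal :=
  ((∫⁻ z, ENNReal.ofReal (-(f z * Real.log (f z))) : ℝ≥0∞) : EReal) -
    ((∫⁻ z, ENNReal.ofReal (f z * Real.log (f z)) : ℝ≥0∞) : EReal)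

/-- The configuration space `ℝᵈ`. -/
abbrev Space (d : ℕ) : Type := EuclideanSpace ℝ (Fin d)

/-- The phase space `ℝ²ᵈ`, with points `z = (x, ω)` and Lebesgue measure. -/
abbrev Phase (d : ℕ) : Type := Space d × Space d

/-- The Hilbert space `L²(ℝᵈ)`. -/
abbrev L2 (d : ℕ) : Type := Lp ℂ 2 (volume : Measure (Space d))

variable {d : ℕ}

/-- The function `t ↦ e^{2πi t·ω} f(t - x)` for `z = (x, ω)`. -/
def tfShiftFun (z : Phase d) (f : Space d → ℂ) (t : Space d) : ℂ :=
  Complex.exp (2 * Real.pi * Complex.I * (inner ℝ t z.2 : ℝ)) * f (t - z.1)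

theorem norm_tfShiftFun (z : Phase d) (f : Space d → ℂ) (t : Space d) :
    ‖tfShiftFun z f t‖ = ‖f (t - z.1)‖ := by
  have h : (2 * Real.pi * Complex.I * (inner ℝ t z.2 : ℝ) : ℂ)
      = ((2 * Real.pi * (inner ℝ t z.2 : ℝ) : ℝ) : ℂ) * Complex.I := by push_cast; ring
  rw [tfShiftFun, norm_mul, h, Complex.norm_exp_ofReal_mul_I, one_mul]

theorem memLp_tfShiftFun (z : Phase d) {f : Space d → ℂ} (hf : MemLp f 2 volume) :
    MemLp (tfShiftFun z f) 2 volume := by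
  have h1 : MemLp (fun t => f (t - z.1)) 2 volume :=
    hf.comp_measurePreserving (measurePreserving_sub_right volume z.1)
  refine h1.of_le ?_ (Filter.Eventually.of_forall fun t => (norm_tfShiftFun z f t).le)
  refine AEStronglyMeasurable.mul (Continuous.aestronglyMeasurable ?_) h1.aestronglyMeasurable
  fun_prop

theorem tfShiftFun_congr (z : Phase d) {f g : Space d → ℂ} (h : f =ᵐ[volume] g) :
    tfShiftFun z f =ᵐ[volume] tfShiftFun z g := by
  have := (measurePreserving_sub_right (volume : Measure (Space d)) z.1).quasiMeasurePreserving.ae h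
  filter_upwards [this] with t ht
  simp only [tfShiftFun, ht]

/-- The time-frequency shift `π(z)` on `L²(ℝᵈ)`, `π(z)f(t) = e^{2πi t·ω} f(t - x)`. -/
def tfShift (z : Phase d) : L2 d →ₗᵢ[ℂ] L2 d where
  toFun f := (memLp_tfShiftFun z (Lp.memLp f)).toLp _
  map_add' f g := by
    rw [← MemLp.toLp_add, MemLp.toLp_eq_toLp_iff]
    refine (tfShiftFun_congr z (Lp.coeFn_add f g)).trans (Filter.Eventually.of_forall fun t => ?_)
    simp [tfShiftFun, mul_add]
  map_smul' c f := by
    rw [RingHom.id_apply, ← MemLp.toLp_const_smul, MemLp.toLp_eq_toLp_iff]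
    refine (tfShiftFun_congr z (Lp.coeFn_smul c f)).trans (Filter.Eventually.of_forall fun t => ?_)
    simp [tfShiftFun, mul_left_comm]
  norm_map' f := by
    change ‖(memLp_tfShiftFun z (Lp.memLp f)).toLp _‖ = ‖f‖
    rw [Lp.norm_toLp, Lp.norm_def]
    congr 1
    rw [← eLpNorm_comp_measurePreserving (Lp.aestronglyMeasurable f)
      (measurePreserving_sub_right (volume : Measure (Space d)) z.1)]
    exact eLpNorm_congr_norm_ae (Filter.Eventually.of_forall fun t => norm_tfShiftFun z f t)

/-- The reflection `Pf(x) = f(-x)` on `L²(ℝᵈ)`. -/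
def reflection : L2 d →ₗᵢ[ℂ] L2 d :=
  Lp.compMeasurePreservingₗᵢ ℂ (fun x : Space d => -x) (Measure.measurePreserving_neg volume)

/-- The translation `α_z(S) = π(z) S π(z)*` of an operator `S`. -/
def shift (z : Phase d) (S : L2 d →L[ℂ] L2 d) : L2 d →L[ℂ] L2 d :=
  (tfShift z).toContinuousLinearMap ∘L S ∘L
    ContinuousLinearMap.adjoint (tfShift z).toContinuousLinearMap

/-- The operator `Š = P S P`. -/
def check (S : L2 d →L[ℂ] L2 d) : L2 d →L[ℂ] L2 d :=
  (reflection (d := d)).toContinuousLinearMap ∘L S ∘L (reflection (d := d)).toContinuousLinearMap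

/-- The convolution `f ⋆ S = ∫ f(z) α_z(S) dz` of `f ∈ L¹(ℝ²ᵈ)` with a trace class operator,
an operator on `L²(ℝᵈ)`. -/
def funConv (f : Phase d → ℂ) (S : L2 d →L[ℂ] L2 d) : L2 d →L[ℂ] L2 d :=
  ∫ z, f z • shift z S

/-- The convolution `S ⋆ T(z) = tr (S α_z(Ť))` of two trace class operators, a function on
`ℝ²ᵈ`. -/
def opConv (S T : L2 d →L[ℂ] L2 d) (z : Phase d) : ℂ := trace (S ∘L shift z (check T))

/-- The total correlation function `S̃ = S ⋆ Š`, which is real-valued for a density operator. -/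
def totalCorrelation (S : L2 d →L[ℂ] L2 d) (z : Phase d) : ℝ := (opConv S (check S) z).re

/-- The normalized indicator function `χ_Ω / |Ω|`. -/
def normalizedIndicator (Ω : Set (Phase d)) : Phase d → ℝ :=
  Ω.indicator fun _ => (volume.real Ω)⁻¹

end

end QHA

namespace QHA

open Filter Topology InnerProductSpace FourierTransform

/-! Both entropy comparisons are one Jensen argument. Let `T` be a density operator with eigenbasis
`c k` and eigenvalues `μ k`, and put p_k(z) = ⟨c_k, α_z(S) c_k⟩. Then f(z) = tr(T α_z(S)) = ∑ μ_k
p_k(z). For fixed z the p_k(z) sum to tr α_z(S) = 1, so concavity of η(x) = -x log x gives η(f(z)) ≥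
∑ η(μ_k) p_k(z). For fixed k Moyal's identity gives ∫ p_k = tr S · ‖c_k‖² = 1, so integrating in z
yields H(f) ≥ ∑ η(μ_k) = H_vN(T); this is `vonNeumannEntropy_le_lintegral`. The choice T = S gives f
= S̃. The choice T = w ⋆ S gives f = w ∗ S̃, by the associativity in
`ofReal_convolution_totalCorrelation`.

For the lower bound, the eigenvalues of w ⋆ S are ∫ w p_k ≤ sup w = 1/|Ω|, so -log μ_k ≥ log |Ω|,
and averaging with the weights μ_k gives the claim.

Sums and integrals of nonnegative terms are taken in [0, ∞], where they may be interchanged freely.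
Since f ≤ 1, no difference ∞ - ∞ occurs in the differential entropy. -/

theorem hasSum_norm_inner_sq {H : Type*} [NormedAddCommGroup H] [InnerProductSpace ℂ H]
    {ι : Type*} (b : HilbertBasis ι ℂ H) (x : H) :
    HasSum (fun i => ‖⟪b i, x⟫_ℂ‖ ^ 2) (‖x‖ ^ 2) := by
  have h := (b.hasSum_inner_mul_inner x x).mapL Complex.reCLM
  convert! h using 1
  · funext i
    rw [← inner_conj_symm x (b i), mul_comm, Complex.mul_conj, Complex.normSq_eq_norm_sq]
    exact (Complex.ofReal_re _).symm
  · rw [inner_self_eq_norm_sq_to_K]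
    simp [← Complex.ofReal_pow]

theorem isCompactOperator_rankOne {H : Type*} [NormedAddCommGroup H] [InnerProductSpace ℂ H]
    (x y : H) :
    IsCompactOperator (rankOne ℂ x y : H →L[ℂ] H) := by
  rw [rankOne_def']
  have h : IsCompactOperator (ContinuousLinearMap.toSpanSingleton ℂ x : ℂ →L[ℂ] H) :=
    isCompactOperator_of_locallyCompactSpace_rng (ContinuousLinearMap.toSpanSingleton ℂ x)
  exact h.comp_clm _

/-- Subtracting the truncation kills the coefficients in `F` and leaves ⟨A b_i, y⟩ outside it.
Cauchy–Schwarz then bounds the error by the Hilbert–Schmidt tail of `A`. -/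
theorem ofReal_norm_sub_sq_le {H : Type*} [NormedAddCommGroup H] [InnerProductSpace ℂ H]
    {ι : Type*} (b : HilbertBasis ι ℂ H)
    {A : H →L[ℂ] H} (hA : ∀ x y, ⟪A x, y⟫_ℂ = ⟪x, A y⟫_ℂ) (F : Finset ι) (y : H) :
    ENNReal.ofReal (‖(A - ∑ i ∈ F, rankOne ℂ (b i) (A (b i))) y‖ ^ 2) ≤
      (∑' i : {i // i ∉ F}, ENNReal.ofReal (‖A (b i)‖ ^ 2)) * ENNReal.ofReal (‖y‖ ^ 2) := by
  classical
  rw [ofReal_norm_sq_eq_tsum b, ← ENNReal.tsum_mul_right,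
    ← tsum_subtype_eq_of_support_subset (s := {i | i ∉ F})]
  · refine ENNReal.tsum_le_tsum fun i => ?_
    rw [← ENNReal.ofReal_mul (by positivity)]
    refine ENNReal.ofReal_le_ofReal ?_
    have : ⟪b i, (A - ∑ i ∈ F, rankOne ℂ (b i) (A (b i))) y⟫_ℂ = ⟪A (b i), y⟫_ℂ := by
      have h0 : ∑ j ∈ F, ⟪b j, A y⟫_ℂ * ⟪b i, b j⟫_ℂ = 0 :=
        Finset.sum_eq_zero fun j hj => by
          rw [b.orthonormal.2 (fun h : (i : ι) = j => (i.2 : (i : ι) ∉ F) (h ▸ hj)), mul_zero]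
      rw [hA, sub_apply, inner_sub_right, sum_apply, inner_sum]
      simp only [rankOne_apply, inner_smul_right, hA, h0, sub_zero]
    rw [this, ← mul_pow]
    gcongr
    exact norm_inner_le_norm _ _
  · intro i hi
    by_contra h
    simp only [Set.mem_ofPred_eq, not_not] at h
    have h0 : ∑ j ∈ F, ⟪b j, A y⟫_ℂ * ⟪b i, b j⟫_ℂ = ⟪b i, A y⟫_ℂ := by
      simp [orthonormal_iff_ite.1 b.orthonormal, h]
    have h1 : ⟪b i, (A - ∑ i ∈ F, rankOne ℂ (b i) (A (b i))) y⟫_ℂ = 0 := by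
      rw [sub_apply, inner_sub_right, sum_apply, inner_sum]
      simp only [rankOne_apply, inner_smul_right, hA, h0, sub_self]
    exact hi (by simp only [h1]; simp)

/-! ### Positive trace class operators: spectral theorem, traces, entropy -/

section Hilbert

universe u

variable {H : Type u} [NormedAddCommGroup H] [InnerProductSpace ℂ H] [CompleteSpace H]

theorem re_inner_eq_norm_sqrt_sq {T : H →L[ℂ] H} (hT : T.IsPositive) (x : H) :
    (⟪x, T x⟫_ℂ).re = ‖CFC.sqrt T x‖ ^ 2 := by
  have hT0 : 0 ≤ T := (ContinuousLinearMap.nonneg_iff_isPositive T).2 hT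
  have hR : (CFC.sqrt T).IsPositive :=
    (ContinuousLinearMap.nonneg_iff_isPositive _).1 (CFC.sqrt_nonneg T)
  have : T x = CFC.sqrt T (CFC.sqrt T x) := by
    rw [← mul_apply_eq_comp, CFC.sqrt_mul_sqrt_self T hT0]
  have h2 : ⟪CFC.sqrt T x, CFC.sqrt T x⟫_ℂ = ⟪x, CFC.sqrt T (CFC.sqrt T x)⟫_ℂ :=
    hR.isSymmetric _ _
  rw [this, ← h2, inner_self_eq_norm_sq_to_K]
  simp [← Complex.ofReal_pow]

theorem sqrt_isSymmetric (T : H →L[ℂ] H) (x y : H) :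
    ⟪CFC.sqrt T x, y⟫_ℂ = ⟪x, CFC.sqrt T y⟫_ℂ :=
  ((ContinuousLinearMap.nonneg_iff_isPositive _).1 (CFC.sqrt_nonneg T)).isSymmetric x y

theorem posTrace_eq_tsum_norm_sqrt {ι : Type*} (b : HilbertBasis ι ℂ H) {T : H →L[ℂ] H}
    (hT : T.IsPositive) :
    posTrace T = ∑' i, ENNReal.ofReal (‖CFC.sqrt T (b i)‖ ^ 2) := by
  simp only [posTrace_eq_of_hilbertBasis b hT, re_inner_eq_norm_sqrt_sq hT]

theorem ofReal_re_inner_le_posTrace_mul {T : H →L[ℂ] H} (hT : T.IsPositive) (x : H) :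
    ENNReal.ofReal (⟪x, T x⟫_ℂ).re ≤ posTrace T * ENNReal.ofReal (‖x‖ ^ 2) := by
  rw [re_inner_eq_norm_sqrt_sq hT, ofReal_norm_sq_eq_tsum (basis H),
    posTrace_eq_tsum_norm_sqrt (basis H) hT, ← ENNReal.tsum_mul_right]
  refine ENNReal.tsum_le_tsum fun i => ?_
  rw [← ENNReal.ofReal_mul (by positivity), ← sqrt_isSymmetric, ← mul_pow]
  exact ENNReal.ofReal_le_ofReal (by gcongr; exact norm_inner_le_norm _ _)

/-- Finite trace makes √T Hilbert–Schmidt, hence a norm limit of finite rank truncations;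
compactness passes to T = √T √T. -/
theorem isCompactOperator_of_posTrace_ne_top {T : H →L[ℂ] H} (hT : T.IsPositive)
    (h : posTrace T ≠ ∞) : IsCompactOperator T := by
  set A := CFC.sqrt T with hAdef
  have hA := sqrt_isSymmetric T
  rw [posTrace_eq_tsum_norm_sqrt (basis H) hT] at h
  have hAc : IsCompactOperator A := by
    refine isCompactOperator_of_tendsto (l := atTop)
      (F := fun F : Finset (basisIndex H) =>
        ∑ i ∈ F, rankOne ℂ (basis H i) (A (basis H i))) ?_ ?_
    · have h0 := ENNReal.tendsto_tsum_compl_atTop_zero h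
      have h1 : Tendsto (fun F : Finset (basisIndex H) => Real.sqrt
          (∑' i : {i // i ∉ F}, ENNReal.ofReal (‖A (basis H i)‖ ^ 2)).toReal) atTop (𝓝 0) := by
        have := (ENNReal.tendsto_toReal ENNReal.zero_ne_top).comp h0
        have h2 := (Real.continuous_sqrt.tendsto _).comp this
        rwa [ENNReal.toReal_zero, Real.sqrt_zero] at h2
      rw [tendsto_iff_norm_sub_tendsto_zero]
      refine squeeze_zero (fun _ => norm_nonneg _) (fun F => ?_) h1
      rw [norm_sub_rev]
      refine ContinuousLinearMap.opNorm_le_bound _ (Real.sqrt_nonneg _) fun y => ?_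
      have h2 := ofReal_norm_sub_sq_le (basis H) hA F y
      have hfin : (∑' i : {i // i ∉ F}, ENNReal.ofReal (‖A (basis H i)‖ ^ 2)) ≠ ∞ :=
        ne_top_of_le_ne_top h (ENNReal.tsum_comp_le_tsum_of_injective Subtype.val_injective _)
      have h3 := ENNReal.toReal_mono (ENNReal.mul_ne_top hfin ENNReal.ofReal_ne_top) h2
      rw [ENNReal.toReal_mul, ENNReal.toReal_ofReal (by positivity),
        ENNReal.toReal_ofReal (by positivity)] at h3
      rw [← Real.sqrt_sq (norm_nonneg y), ← Real.sqrt_mul ENNReal.toReal_nonneg]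
      exact Real.le_sqrt_of_sq_le h3
    · refine Eventually.of_forall fun F => ?_
      induction F using Finset.cons_induction with
      | empty => simpa using isCompactOperator_zero
      | cons a s ha ih =>
        rw [Finset.sum_cons]
        exact (isCompactOperator_rankOne _ _).add ih
  have hT0 : 0 ≤ T := (ContinuousLinearMap.nonneg_iff_isPositive T).2 hT
  rw [← CFC.sqrt_mul_sqrt_self T hT0]
  exact hAc.comp_clm A

/-- The spectral theorem: a positive trace class operator has an orthonormal basis of
eigenvectors. -/
theorem exists_hilbertBasis_eigenvectors {T : H →L[ℂ] H} (hT : T.IsPositive)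
    (h : posTrace T ≠ ∞) :
    ∃ (ι : Type u) (b : HilbertBasis ι ℂ H) (m : ι → ℝ),
      (∀ i, 0 ≤ m i) ∧ ∀ i, T (b i) = (m i : ℂ) • b i := by
  have hbot := ContinuousLinearMap.orthogonalComplement_iSup_eigenspaces_eq_bot
    (isCompactOperator_of_posTrace_ne_top hT h) hT.isSymmetric
  have hcl : ∀ μ, IsClosed ((Module.End.eigenspace (T : Module.End ℂ H) μ : Set H)) := fun μ => by
    have : (Module.End.eigenspace (T : Module.End ℂ H) μ : Set H) = {x | T x = μ • x} := by
      ext x; simp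
    rw [this]
    exact isClosed_eq T.continuous (continuous_const_smul μ)
  have hcs : ∀ μ, CompleteSpace (Module.End.eigenspace (T : Module.End ℂ H) μ) := fun μ =>
    (hcl μ).completeSpace_coe
  -- Orthonormal bases of the separate eigenspaces are glued together: the eigenspaces are mutually
  -- orthogonal and their sum is dense.
  choose w c hc using fun μ =>
    exists_hilbertBasis ℂ (Module.End.eigenspace (T : Module.End ℂ H) μ)
  have hon : Orthonormal ℂ fun a : Σ μ, w μ => ((c a.1 a.2 :
      Module.End.eigenspace (T : Module.End ℂ H) a.1) : H) :=
    hT.isSymmetric.orthogonalFamily_eigenspaces.orthonormal_sigma_orthonormal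
      fun μ => (c μ).orthonormal
  have hsp : (Submodule.span ℂ (Set.range fun a : Σ μ, w μ => ((c a.1 a.2 :
      Module.End.eigenspace (T : Module.End ℂ H) a.1) : H)))ᗮ = ⊥ := by
    rw [eq_bot_iff, ← hbot]
    rw [← Submodule.orthogonal_closure]
    refine Submodule.orthogonal_le (iSup_le fun μ v hv => ?_)
    have hs := ((c μ).hasSum_repr ⟨v, hv⟩).mapL
      (Module.End.eigenspace (T : Module.End ℂ H) μ).subtypeL
    refine mem_closure_of_tendsto hs (Eventually.of_forall fun F => ?_)
    refine Submodule.sum_mem _ fun i _ => ?_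
    simp only [map_smul]
    exact Submodule.smul_mem _ _ (Submodule.subset_span ⟨⟨μ, i⟩, rfl⟩)
  set b := HilbertBasis.mkOfOrthogonalEqBot hon hsp with hb
  have hbi : ∀ a, T (b a) = a.1 • b a := fun a => by
    rw [hb, HilbertBasis.coe_mkOfOrthogonalEqBot]
    exact Module.End.mem_eigenspace_iff.1 (c a.1 a.2).2
  refine ⟨_, b, fun a => a.1.re, fun a => ?_, fun a => ?_⟩
  · have := hT.re_inner_nonneg_right (b a)
    rw [hbi, inner_smul_right, inner_self_eq_norm_sq_to_K, b.orthonormal.1] at this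
    simpa using this
  -- The eigenvalues are a priori complex; symmetry shows that passing to the real part loses
  -- nothing.
  · have := hT.isSymmetric (b a) (b a)
    rw [ContinuousLinearMap.coe_coe, hbi, inner_smul_right, inner_smul_left,
      inner_self_eq_norm_sq_to_K, b.orthonormal.1] at this
    have h2 : (a.1.re : ℂ) = a.1 := Complex.conj_eq_iff_re.1 (by simpa using this)
    rw [hbi, h2]

/-- By Stone–Weierstrass it suffices to check constants, the identity, sums, products and limits.
The value f(μ) makes sense for functions on the spectrum because a nonzero eigenvector puts μ there.
-/
theorem cfc_apply_eigenvector {T : H →L[ℂ] H} (hT : IsSelfAdjoint T) {f : ℝ → ℝ}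
    (hf : Continuous f) {μ : ℝ} {v : H} (hv : T v = (μ : ℂ) • v) :
    cfc f T v = (f μ : ℂ) • v := by
  rcases eq_or_ne v 0 with rfl | hv0
  · simp
  have hμ : μ ∈ spectrum ℝ T := by
    rw [spectrum.mem_iff]
    rintro ⟨u, hu⟩
    apply hv0
    have h1 : (u : H →L[ℂ] H) v = 0 := by
      rw [hu]; simp [hv, Algebra.algebraMap_eq_smul_one]
    calc v = ((↑u⁻¹ * ↑u : H →L[ℂ] H)) v := by simp
      _ = 0 := by rw [mul_apply_eq_comp, h1, map_zero]
  have key : ∀ g : C(spectrum ℝ T, ℝ), cfcHom hT g v = (g ⟨μ, hμ⟩ : ℂ) • v := by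
    intro g
    induction g using ContinuousMap.induction_on_of_compact with
    | const r =>
      have : ContinuousMap.const (spectrum ℝ T) r = algebraMap ℝ _ r := rfl
      rw [this, AlgHomClass.commutes, Algebra.algebraMap_eq_smul_one]
      simp
    | id =>
      rw [cfcHom_id hT]
      simpa using hv
    | star_id =>
      rw [map_star, cfcHom_id hT, hT.star_eq]
      simpa using hv
    | add f g hf hg => simp [hf, hg, add_smul]
    | mul f g hf hg =>
      rw [map_mul, mul_apply_eq_comp, hg, map_smul, hf, smul_smul]
      simp [mul_comm]
    | frequently f h =>
      have hcl : IsClosed {g : C(spectrum ℝ T, ℝ) | cfcHom hT g v = (g ⟨μ, hμ⟩ : ℂ) • v} := by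
        refine isClosed_eq ?_ ?_
        · exact (ContinuousLinearMap.apply ℂ H v).continuous.comp (cfcHom_continuous hT)
        · exact (Complex.continuous_ofReal.comp (continuous_eval_const (F := C(spectrum ℝ T, ℝ)) _)).smul
            continuous_const
      exact hcl.mem_of_frequently_of_tendsto h tendsto_id
  rw [cfc_apply f T hT hf.continuousOn, key]
  rfl

section Eigenbasis

variable {ι : Type*} {b : HilbertBasis ι ℂ H} {m : ι → ℝ} {T : H →L[ℂ] H}

theorem posTrace_eq_tsum_eigenvalues (hT : T.IsPositive)
    (hb : ∀ i, T (b i) = (m i : ℂ) • b i) : posTrace T = ∑' i, ENNReal.ofReal (m i) := by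
  rw [posTrace_eq_of_hilbertBasis b hT]
  refine tsum_congr fun i => ?_
  rw [hb, inner_smul_right, inner_self_eq_norm_sq_to_K, b.orthonormal.1]
  simp

theorem summable_eigenvalues (hT : T.IsPositive) (h : posTrace T ≠ ∞) (hm : ∀ i, 0 ≤ m i)
    (hb : ∀ i, T (b i) = (m i : ℂ) • b i) : Summable m := by
  rw [posTrace_eq_tsum_eigenvalues hT hb] at h
  simpa [ENNReal.toReal_ofReal (hm _)] using ENNReal.summable_toReal h

theorem hasSum_rankOne (hm : ∀ i, 0 ≤ m i) (hs : Summable m)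
    (hb : ∀ i, T (b i) = (m i : ℂ) • b i) :
    HasSum (fun i => (m i : ℂ) • rankOne ℂ (b i) (b i)) T := by
  have hsum : Summable fun i => (m i : ℂ) • rankOne ℂ (b i) (b i) := by
    refine Summable.of_norm ?_
    simpa [norm_smul, b.orthonormal.1, abs_of_nonneg (hm _)] using hs
  convert! hsum.hasSum using 1
  ext x
  have h1 := (b.hasSum_repr x).mapL T
  have h2 := hsum.hasSum.mapL (ContinuousLinearMap.apply ℂ H x)
  refine h1.unique ?_
  convert! h2 using 1
  ext i
  simp only [map_smul, hb, b.repr_apply_apply, ContinuousLinearMap.apply_apply,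
    rankOne_apply]
  exact smul_comm _ _ _

theorem hasSum_inner_apply (hm : ∀ i, 0 ≤ m i) (hs : Summable m)
    (hb : ∀ i, T (b i) = (m i : ℂ) • b i) (x y : H) :
    HasSum (fun i => (m i : ℂ) * (⟪x, b i⟫_ℂ * ⟪b i, y⟫_ℂ)) ⟪x, T y⟫_ℂ := by
  have h := (hasSum_rankOne hm hs hb).mapL (innerSL ℂ x ∘L ContinuousLinearMap.apply ℂ H y)
  convert! h using 1
  ext i
  simp [mul_comm]

theorem ofReal_re_inner_apply (hm : ∀ i, 0 ≤ m i) (hs : Summable m)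
    (hb : ∀ i, T (b i) = (m i : ℂ) • b i) (x : H) :
    ENNReal.ofReal (⟪x, T x⟫_ℂ).re =
      ∑' i, ENNReal.ofReal (m i) * ENNReal.ofReal (‖⟪b i, x⟫_ℂ‖ ^ 2) := by
  have h := (hasSum_inner_apply hm hs hb x x).mapL Complex.reCLM
  have h' : HasSum (fun i => m i * ‖⟪b i, x⟫_ℂ‖ ^ 2) (⟪x, T x⟫_ℂ).re := by
    convert! h using 1
    funext i
    rw [← inner_conj_symm x (b i), mul_comm (starRingEnd ℂ _), Complex.mul_conj,
      Complex.normSq_eq_norm_sq, ← Complex.ofReal_mul]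
    exact (Complex.ofReal_re _).symm
  rw [← h'.tsum_eq, ENNReal.ofReal_tsum_of_nonneg
    (fun i => mul_nonneg (hm i) (by positivity)) h'.summable]
  exact tsum_congr fun i => ENNReal.ofReal_mul (hm i)

/-- The trace of `T R`, computed in an eigenbasis of the positive trace class operator `T`. -/
theorem hasSum_trace_comp (hm : ∀ i, 0 ≤ m i) (hs : Summable m)
    (hb : ∀ i, T (b i) = (m i : ℂ) • b i) (R : H →L[ℂ] H) :
    HasSum (fun k => (m k : ℂ) * ⟪b k, R (b k)⟫_ℂ) (trace (T ∘L R)) := by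
  set e := basis H with he
  set g : ι × basisIndex H → ℂ := fun p => (m p.1 : ℂ) *
    (⟪ContinuousLinearMap.adjoint R (b p.1), e p.2⟫_ℂ * ⟪e p.2, b p.1⟫_ℂ) with hg
  have hin : ∀ k, HasSum (fun i => g (k, i)) ((m k : ℂ) * ⟪b k, R (b k)⟫_ℂ) := fun k => by
    rw [← ContinuousLinearMap.adjoint_inner_left]
    exact (e.hasSum_inner_mul_inner _ _).mul_left _
  have hout : ∀ i, HasSum (fun k => g (k, i)) ⟪e i, (T ∘L R) (e i)⟫_ℂ := fun i => by
    convert! hasSum_inner_apply hm hs hb (e i) (R (e i)) using 1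
    funext k
    simp only [hg, ContinuousLinearMap.adjoint_inner_left]
    ring
  -- Absolute summability over pairs justifies swapping the two bases. By |xy| ≤ (x² + y²)/2 and
  -- Parseval, the k-th row is at most m_k (‖R*‖² + 1)/2.
  have hprod : Summable g := by
    rw [← summable_norm_iff, summable_prod_of_nonneg (fun _ => norm_nonneg _)]
    refine ⟨fun k => (hin k).summable.norm, ?_⟩
    refine Summable.of_nonneg_of_le (fun k => tsum_nonneg fun _ => norm_nonneg _) (fun k => ?_)
      (hs.mul_right ((‖ContinuousLinearMap.adjoint R‖ ^ 2 + 1) / 2))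
    set x := ContinuousLinearMap.adjoint R (b k) with hx
    have h1 := (((hasSum_norm_inner_sq e x).add (hasSum_norm_inner_sq e (b k))).div_const
      2).mul_left (m k)
    refine ((hin k).summable.norm.tsum_le_tsum (fun i => ?_) h1.summable).trans ?_
    · simp only [hg, norm_mul, Complex.norm_real, Real.norm_of_nonneg (hm k)]
      refine mul_le_mul_of_nonneg_left ?_ (hm k)
      rw [← hx, norm_inner_symm x]
      nlinarith [sq_nonneg (‖⟪e i, x⟫_ℂ‖ - ‖⟪e i, b k⟫_ℂ‖)]
    · rw [h1.tsum_eq]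
      have h2 : ‖x‖ ≤ ‖ContinuousLinearMap.adjoint R‖ := by
        simpa [b.orthonormal.1] using (ContinuousLinearMap.adjoint R).le_opNorm (b k)
      refine mul_le_mul_of_nonneg_left ?_ (hm k)
      rw [b.orthonormal.1, one_pow]
      gcongr
  have h1 := hprod.hasSum.prod_fiberwise hin
  have h2 := (Summable.hasSum ((Equiv.prodComm _ _).summable_iff.2 hprod)).prod_fiberwise hout
  change HasSum _ (∑' p, g ((Equiv.prodComm _ _) p)) at h2
  rw [(Equiv.prodComm _ _).tsum_eq g] at h2
  rw [trace, ← he, h2.tsum_eq]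
  exact h1

/-- A trace at most 1 forces T ≤ 1, so the spectrum lies in [0, 1], where -x log x is nonnegative.
-/
theorem cfc_negMulLog_isPositive (hT : T.IsPositive) (h : posTrace T ≤ 1) :
    (cfc Real.negMulLog T).IsPositive := by
  rw [← ContinuousLinearMap.nonneg_iff_isPositive]
  refine cfc_nonneg fun x hx => Real.negMulLog_nonneg ?_ ?_
  · exact spectrum_nonneg_of_nonneg ((ContinuousLinearMap.nonneg_iff_isPositive T).2 hT) hx
  · have hc : T ≤ algebraMap ℝ (H →L[ℂ] H) 1 := by
      rw [map_one, ContinuousLinearMap.le_def, ContinuousLinearMap.isPositive_def']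
      refine ⟨(IsSelfAdjoint.one _).sub hT.isSelfAdjoint, fun x => ?_⟩
      have h1 := (ofReal_re_inner_le_posTrace_mul hT x).trans (mul_le_of_le_one_left' h)
      rw [ENNReal.ofReal_le_ofReal_iff (by positivity)] at h1
      simp only [ContinuousLinearMap.reApplyInnerSelf_apply, sub_apply, one_apply_eq_self,
        inner_sub_left, map_sub, inner_self_eq_norm_sq, sub_nonneg]
      rw [← inner_re_symm]
      exact h1
    exact (le_algebraMap_iff_spectrum_le (ha := hT.isSelfAdjoint)).1 hc x hx

theorem vonNeumannEntropy_eq_tsum (hT : T.IsPositive) (h : posTrace T ≤ 1)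
    (hb : ∀ i, T (b i) = (m i : ℂ) • b i) :
    vonNeumannEntropy T = ∑' i, ENNReal.ofReal (Real.negMulLog (m i)) := by
  rw [vonNeumannEntropy, posTrace_eq_of_hilbertBasis b (cfc_negMulLog_isPositive hT h)]
  refine tsum_congr fun i => ?_
  rw [cfc_apply_eigenvector hT.isSelfAdjoint Real.continuous_negMulLog (hb i), inner_smul_right,
    inner_self_eq_norm_sq_to_K, b.orthonormal.1]
  simp

end Eigenbasis

/-- The trace is the squared Hilbert–Schmidt norm of √T V*, equal to that of its adjoint V √T, and V
preserves norms. Surjectivity of V plays no role. -/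
theorem posTrace_conj_isometry {T : H →L[ℂ] H} (hT : T.IsPositive) (V : H →ₗᵢ[ℂ] H) :
    posTrace (V.toContinuousLinearMap ∘L T ∘L
      ContinuousLinearMap.adjoint V.toContinuousLinearMap) = posTrace T := by
  set A := CFC.sqrt T
  set W := ContinuousLinearMap.adjoint V.toContinuousLinearMap with hW
  have h1 : ∀ x, (⟪x, (V.toContinuousLinearMap ∘L T ∘L W) x⟫_ℂ).re = ‖A (W x)‖ ^ 2 := fun x => by
    rw [← re_inner_eq_norm_sqrt_sq hT, ContinuousLinearMap.comp_apply,
      ← ContinuousLinearMap.adjoint_inner_left]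
    rfl
  have h2 : ∀ x y, ‖⟪y, A (W x)⟫_ℂ‖ = ‖⟪x, V (A y)⟫_ℂ‖ := fun x y => by
    rw [← sqrt_isSymmetric, hW, ContinuousLinearMap.adjoint_inner_right, norm_inner_symm]
    rfl
  rw [posTrace_eq_tsum_norm_sqrt (basis H) hT]
  simp only [posTrace, h1]
  simp only [ofReal_norm_sq_eq_tsum (basis H) (A (W _)), h2]
  rw [ENNReal.tsum_comm]
  simp only [← ofReal_norm_sq_eq_tsum, V.norm_map]
  rfl

end Hilbert

/-! ### Plancherel for Fourier integrals on L¹ ∩ L² -/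

section Plancherel

variable {V : Type*} [NormedAddCommGroup V] [InnerProductSpace ℝ V] [FiniteDimensional ℝ V]
  [MeasurableSpace V] [BorelSpace V]

/-- The Fourier integral of a function in `L¹ ∩ L²` represents its `L²` Fourier transform. -/
theorem coeFn_fourier_toLp {f : V → ℂ} (h1 : Integrable f) (h2 : MemLp f 2) :
    (𝓕 (h2.toLp f) : Lp ℂ 2 (volume : Measure V)) =ᵐ[volume] 𝓕 f := by
  have hc : Continuous (𝓕 f) := VectorFourier.fourierIntegral_continuous
    Real.continuous_fourierChar (by exact continuous_inner) h1
  refine ae_eq_of_integral_contDiff_smul_eq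
    ((Lp.memLp _).locallyIntegrable (by norm_num)) hc.locallyIntegrable fun g hg hgc => ?_
  have hg1 : HasCompactSupport (Complex.ofRealCLM ∘ g) := hgc.comp_left rfl
  have hg2 : ContDiff ℝ ((⊤ : ℕ∞) : WithTop ℕ∞) (Complex.ofRealCLM ∘ g) :=
    Complex.ofRealCLM.contDiff.comp hg
  set G : SchwartzMap V ℂ := hg1.toSchwartzMap hg2
  have hGg : ∀ x, G x = (g x : ℂ) := fun x => rfl
  -- Against a test function G both transforms give ∫ (𝓕 G) f: the L² one through tempered
  -- distributions, the integral one through Fubini.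
  have e1 := Lp.toTemperedDistribution_apply (𝓕 (h2.toLp f) : Lp ℂ 2 (volume : Measure V)) G
  rw [← Lp.fourier_toTemperedDistribution_eq, TemperedDistribution.fourier_apply,
    Lp.toTemperedDistribution_apply] at e1
  have e2 : ∫ x, (𝓕 G) x • (h2.toLp f) x = ∫ x, (𝓕 G) x • f x := by
    refine integral_congr_ae ?_
    filter_upwards [h2.coeFn_toLp] with x hx
    rw [hx]
  have e3 := VectorFourier.integral_fourierIntegral_smul_eq_flip (μ := (volume : Measure V))
    (ν := (volume : Measure V)) (L := innerₗ V) Real.continuous_fourierChar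
    (by exact continuous_inner) (G.integrable (μ := volume)) h1
  rw [flip_innerₗ] at e3
  have e4 : ∫ x, G x • (𝓕 (h2.toLp f) : Lp ℂ 2 (volume : Measure V)) x = ∫ x, G x • (𝓕 f) x := by
    rw [← e1, e2]
    exact e3
  simpa only [hGg, Complex.real_smul, smul_eq_mul] using e4

theorem lintegral_enorm_sq_eq {X : Type*} [MeasurableSpace X] {μ : Measure X} (f : X → ℂ) :
    ∫⁻ x, ‖f x‖ₑ ^ 2 ∂μ = eLpNorm f 2 μ ^ 2 := by
  have := eLpNorm_nnreal_pow_eq_lintegral (f := f) (μ := μ) (p := 2) (by norm_num)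
  simpa using this.symm

/-- Plancherel's theorem for the Fourier integral of a function in `L¹ ∩ L²`. -/
theorem lintegral_enorm_fourier_sq {f : V → ℂ} (h1 : Integrable f) (h2 : MemLp f 2) :
    ∫⁻ ω, ‖𝓕 f ω‖ₑ ^ 2 = ∫⁻ x, ‖f x‖ₑ ^ 2 := by
  rw [lintegral_enorm_sq_eq, lintegral_enorm_sq_eq, ← eLpNorm_congr_ae (coeFn_fourier_toLp h1 h2),
    ← Lp.enorm_def, ← eLpNorm_congr_ae h2.coeFn_toLp, ← Lp.enorm_def, ← ofReal_norm, ← ofReal_norm,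
    Lp.norm_fourier_eq]

end Plancherel

/-! ### Time-frequency shifts and Moyal's identity -/

section TimeFrequency

variable {d : ℕ}

theorem coeFn_tfShift (z : Phase d) (f : L2 d) : tfShift z f =ᵐ[volume] tfShiftFun z f :=
  MemLp.coeFn_toLp (memLp_tfShiftFun z (Lp.memLp f))

theorem tfShiftFun_tfShiftFun (z w : Phase d) (f : Space d → ℂ) (t : Space d) :
    tfShiftFun z (tfShiftFun w f) t =
      Complex.exp (((-2 * Real.pi * inner ℝ z.1 w.2 : ℝ) : ℂ) * Complex.I) *
        tfShiftFun (z + w) f t := by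
  simp only [tfShiftFun, Prod.snd_add, Prod.fst_add, ← mul_assoc, ← Complex.exp_add, sub_sub]
  congr 2
  simp only [inner_sub_left, inner_add_right]
  push_cast
  ring

/-- The Weyl commutation relation: `π(z) π(w)` is `π(z + w)` up to a phase. -/
theorem tfShift_tfShift (z w : Phase d) (f : L2 d) :
    tfShift z (tfShift w f) =
      Complex.exp (((-2 * Real.pi * inner ℝ z.1 w.2 : ℝ) : ℂ) * Complex.I) •
        tfShift (z + w) f := by
  refine Lp.ext ?_
  filter_upwards [coeFn_tfShift z (tfShift w f), tfShiftFun_congr z (coeFn_tfShift w f),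
    Lp.coeFn_smul (Complex.exp (((-2 * Real.pi * inner ℝ z.1 w.2 : ℝ) : ℂ) * Complex.I))
      (tfShift (z + w) f), coeFn_tfShift (z + w) f] with t h1 h2 h3 h4
  rw [h1, h2, h3, Pi.smul_apply, h4, tfShiftFun_tfShiftFun, smul_eq_mul]

theorem norm_inner_tfShift_tfShift (z w : Phase d) (f g : L2 d) :
    ‖⟪tfShift z f, tfShift w g⟫_ℂ‖ = ‖⟪f, tfShift (w - z) g⟫_ℂ‖ := by
  have h := tfShift_tfShift z (w - z) g
  rw [add_sub_cancel] at h
  rw [← (tfShift z).inner_map_map f, h, inner_smul_right, norm_mul, Complex.norm_exp_ofReal_mul_I,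
    one_mul]

theorem tfShift_eq_comp (z : Phase d) (f : L2 d) :
    tfShift z f = tfShift (0, z.2) (tfShift (z.1, 0) f) := by
  rw [tfShift_tfShift]
  simp

theorem continuous_tfShift_fst (f : L2 d) :
    Continuous fun x : Space d => tfShift (x, 0) f := by
  have hg : Continuous fun x : Space d => (⟨fun t => t - x, by fun_prop⟩ : C(Space d, Space d)) :=
    (ContinuousMap.curry (⟨fun p : Space d × Space d => p.2 - p.1, by fun_prop⟩)).continuous
  have h := (continuous_const (y := f)).compMeasurePreservingLp hg
    (fun x => measurePreserving_sub_right (volume : Measure (Space d)) x) (by norm_num)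
  convert! h using 2 with x
  refine Lp.ext ?_
  filter_upwards [coeFn_tfShift (x, 0) f, Lp.coeFn_compMeasurePreserving f
    (measurePreserving_sub_right (volume : Measure (Space d)) x)] with t h1 h2
  rw [h1]
  refine Eq.trans ?_ h2.symm
  simp [tfShiftFun]

theorem continuous_tfShift_snd (f : L2 d) :
    Continuous fun ω : Space d => tfShift (0, ω) f := by
  rw [continuous_iff_continuousAt]
  intro ω₀
  have hin : Continuous fun ω : Space d => ⟪tfShift (0, ω₀) f, tfShift (0, ω) f⟫_ℂ := by
    have h : ∀ ω : Space d, ⟪tfShift (0, ω₀) f, tfShift (0, ω) f⟫_ℂ =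
        ∫ t, ⟪tfShiftFun (0, ω₀) f t, tfShiftFun (0, ω) f t⟫_ℂ := fun ω => by
      rw [L2.inner_def]
      refine integral_congr_ae ?_
      filter_upwards [coeFn_tfShift (0, ω₀) f, coeFn_tfShift (0, ω) f] with t h1 h2
      rw [h1, h2]
    simp only [h]
    refine continuous_of_dominated (bound := fun t => ‖f t‖ ^ 2) (fun ω => ?_) (fun ω => ?_) ?_ ?_
    · exact (memLp_tfShiftFun _ (Lp.memLp f)).1.inner (memLp_tfShiftFun _ (Lp.memLp f)).1
    · refine Eventually.of_forall fun t => (norm_inner_le_norm _ _).trans ?_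
      rw [norm_tfShiftFun, norm_tfShiftFun, sub_zero, sq]
    · exact (Lp.memLp f).integrable_norm_pow (by norm_num)
    · refine Eventually.of_forall fun t => ?_
      simp only [tfShiftFun]
      fun_prop
  rw [ContinuousAt, tendsto_iff_norm_sub_tendsto_zero]
  -- The norms are constant in ω, so continuity of the inner product already gives norm continuity.
  have hsq : ∀ ω : Space d, ‖tfShift (0, ω) f - tfShift (0, ω₀) f‖ =
      Real.sqrt (2 * ‖f‖ ^ 2 - 2 * (⟪tfShift (0, ω₀) f, tfShift (0, ω) f⟫_ℂ).re) := fun ω => by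
    rw [← Real.sqrt_sq (norm_nonneg (_ - _)), norm_sub_rev, norm_sub_sq (𝕜 := ℂ),
      LinearIsometry.norm_map, LinearIsometry.norm_map, RCLike.re_eq_complex_re]
    ring_nf
  have hct : Continuous fun ω : Space d =>
      Real.sqrt (2 * ‖f‖ ^ 2 - 2 * (⟪tfShift (0, ω₀) f, tfShift (0, ω) f⟫_ℂ).re) := by
    fun_prop
  have h0 := hct.tendsto ω₀
  simp only [← hsq] at h0
  simpa using h0

/-- Modulations are isometries, hence uniformly Lipschitz, so separate continuity in frequency and
vector upgrades to joint continuity. -/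
theorem continuous_tfShift (f : L2 d) : Continuous fun z : Phase d => tfShift z f := by
  have h : Continuous fun p : Space d × L2 d => tfShift (0, p.1) p.2 :=
    continuous_prod_of_continuous_lipschitzWith' _ 1
      (fun ω => (tfShift (0, ω)).lipschitz) continuous_tfShift_snd
  have h1 : Continuous fun z : Phase d => tfShift (z.1, 0) f :=
    Continuous.comp (g := fun x : Space d => tfShift (x, 0) f) (f := Prod.fst)
      (continuous_tfShift_fst f) continuous_fst
  have h2 : Continuous fun z : Phase d => tfShift (0, z.2) (tfShift (z.1, 0) f) :=
    Continuous.comp (g := fun p : Space d × L2 d => tfShift (0, p.1) p.2)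
      (f := fun z : Phase d => (z.2, tfShift (z.1, 0) f)) h (continuous_snd.prodMk h1)
  exact h2.congr fun z => (tfShift_eq_comp z f).symm

/-- This is the short-time Fourier transform: at fixed position, Moyal's identity reduces to
Plancherel in the frequency. -/
theorem inner_tfShift_eq_fourier (z : Phase d) (s t : L2 d) :
    ⟪tfShift z s, t⟫_ℂ = 𝓕 (fun u => t u * starRingEnd ℂ (s (u - z.1))) z.2 := by
  rw [L2.inner_def, Real.fourier_eq']
  refine integral_congr_ae ?_
  filter_upwards [coeFn_tfShift z s] with u hu
  rw [hu, RCLike.inner_apply, tfShiftFun, map_mul, ← Complex.exp_conj]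
  simp only [smul_eq_mul, map_mul, Complex.conj_ofReal, Complex.conj_I, map_ofNat]
  push_cast
  ring_nf

/-- Moyal's identity. -/
theorem lintegral_enorm_inner_tfShift_sq (s t : L2 d) :
    ∫⁻ z, ‖⟪tfShift z s, t⟫_ℂ‖ₑ ^ 2 = ‖s‖ₑ ^ 2 * ‖t‖ₑ ^ 2 := by
  have hsm : Measurable s := (Lp.stronglyMeasurable s).measurable
  have htm : Measurable t := (Lp.stronglyMeasurable t).measurable
  have hjm : Measurable fun p : Space d × Space d => t p.2 * starRingEnd ℂ (s (p.2 - p.1)) :=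
    (htm.comp measurable_snd).mul
      (RCLike.continuous_conj.measurable.comp (hsm.comp (measurable_snd.sub measurable_fst)))
  have hsh : ∀ x : Space d, MemLp (fun u => starRingEnd ℂ (s (u - x))) 2 := fun x =>
    ((Lp.memLp s).comp_measurePreserving (measurePreserving_sub_right volume x)).star
  have hint : ∫⁻ x : Space d, ∫⁻ u, ‖t u * starRingEnd ℂ (s (u - x))‖ₑ ^ 2 =
      ‖s‖ₑ ^ 2 * ‖t‖ₑ ^ 2 := by
    rw [lintegral_lintegral_swap (hjm.enorm.pow_const 2).aemeasurable]
    have h1 : ∀ u, ∫⁻ x, ‖t u * starRingEnd ℂ (s (u - x))‖ₑ ^ 2 = ‖t u‖ₑ ^ 2 * ‖s‖ₑ ^ 2 := by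
      intro u
      simp only [enorm_mul, RCLike.enorm_conj, mul_pow]
      rw [lintegral_const_mul _ (by fun_prop),
        lintegral_sub_left_eq_self (fun x => ‖s x‖ₑ ^ 2) u, lintegral_enorm_sq_eq, ← Lp.enorm_def]
    simp only [h1]
    rw [lintegral_mul_const _ (by fun_prop), lintegral_enorm_sq_eq, ← Lp.enorm_def, mul_comm]
  have hcont : Continuous fun z : Phase d => ⟪tfShift z s, t⟫_ℂ :=
    (continuous_tfShift s).inner continuous_const
  rw [← hint, Measure.volume_eq_prod, lintegral_prod _
    (hcont.measurable.enorm.pow_const 2).aemeasurable]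
  -- The product t(u) · conj s(u - x) is in L¹ for every x by Hölder, but its membership in L² is
  -- only obtained for almost every x, from the finite double integral.
  have hfin : ∀ᵐ x : Space d, ∫⁻ u, ‖t u * starRingEnd ℂ (s (u - x))‖ₑ ^ 2 < ∞ := by
    refine ae_lt_top (hjm.enorm.pow_const 2).lintegral_prod_right' ?_
    rw [hint]
    exact ENNReal.mul_ne_top (by simp) (by simp)
  refine lintegral_congr_ae ?_
  filter_upwards [hfin] with x hx
  simp only [inner_tfShift_eq_fourier]
  refine lintegral_enorm_fourier_sq ((Lp.memLp t).integrable_mul (hsh x)) ⟨?_, ?_⟩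
  · exact (hjm.comp (measurable_const.prodMk measurable_id)).aestronglyMeasurable
  · rw [lintegral_enorm_sq_eq] at hx
    simpa using hx

end TimeFrequency

/-! ### Countability of bases, Jensen's inequality, differential entropy -/

theorem ofReal_norm_sq {E : Type*} [NormedAddCommGroup E] (x : E) :
    ENNReal.ofReal (‖x‖ ^ 2) = ‖x‖ₑ ^ 2 := by
  rw [ENNReal.ofReal_pow (norm_nonneg _), ofReal_norm]

/-- Balls of radius 1/2 about points at mutual distance √2 are disjoint. Countability is what allows
sums over a basis to be exchanged with integrals. -/
theorem countable_of_orthonormal {H : Type*} [NormedAddCommGroup H] [InnerProductSpace ℂ H]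
    [SecondCountableTopology H] {ι : Type*} {v : ι → H} (hv : Orthonormal ℂ v) :
    Countable ι := by
  refine Pairwise.countable_of_isOpen_disjoint (s := fun i => Metric.ball (v i) (1 / 2)) ?_
    (fun _ => Metric.isOpen_ball) fun i => Metric.nonempty_ball.2 (by norm_num)
  intro i j hij
  refine Metric.ball_disjoint_ball ?_
  have h : ‖v i - v j‖ ^ 2 = 2 := by
    rw [norm_sub_sq (𝕜 := ℂ), hv.2 hij, hv.1, hv.1]
    norm_num
  rw [dist_eq_norm]
  nlinarith [norm_nonneg (v i - v j)]

/-- The right side is the tangent at y of a concave function; the bound is log t ≤ t - 1 at t = y /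
x. -/
theorem negMulLog_le_tangent {x y : ℝ} (hx : 0 ≤ x) (hy : 0 < y) :
    Real.negMulLog x ≤ y - (1 + Real.log y) * x := by
  rcases hx.eq_or_lt with rfl | hx
  · simpa using hy.le
  have h := mul_le_mul_of_nonneg_left (Real.log_le_sub_one_of_pos (div_pos hy hx)) hx.le
  rw [Real.log_div hy.ne' hx.ne', mul_sub x (y / x), mul_div_cancel₀ _ hx.ne'] at h
  rw [Real.negMulLog]
  linarith

/-- Jensen's inequality for `x ↦ -x log x` and a discrete probability distribution. -/
theorem tsum_negMulLog_le {ι : Type*} {p : ι → ℝ≥0∞} {μ : ι → ℝ} {y : ℝ} (hp : ∑' k, p k = 1)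
    (h0 : ∀ k, 0 ≤ μ k) (h1 : ∀ k, μ k ≤ 1) (hy : 0 ≤ y)
    (h : ENNReal.ofReal y = ∑' k, ENNReal.ofReal (μ k) * p k) :
    ∑' k, ENNReal.ofReal (Real.negMulLog (μ k)) * p k ≤ ENNReal.ofReal (Real.negMulLog y) := by
  -- At y = 0 there is no tangent line, but then each k has μ_k = 0 or p_k = 0 and the left side
  -- vanishes.
  rcases hy.eq_or_lt with rfl | hy
  · rw [ENNReal.ofReal_zero, eq_comm, ENNReal.tsum_eq_zero] at h
    have : ∀ k, ENNReal.ofReal (Real.negMulLog (μ k)) * p k = 0 := fun k => by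
      rcases mul_eq_zero.1 (h k) with hk | hk
      · rw [le_antisymm (ENNReal.ofReal_eq_zero.1 hk) (h0 k)]; simp
      · rw [hk, mul_zero]
    simp [this]
  have hpt : ∀ k, p k ≠ ∞ := ENNReal.ne_top_of_tsum_ne_top (by simp [hp])
  have hq : HasSum (fun k => (p k).toReal) 1 := by
    have := ENNReal.hasSum_toReal (f := p) (by simp [hp])
    rwa [← ENNReal.tsum_toReal_eq hpt, hp, ENNReal.toReal_one] at this
  have hr : HasSum (fun k => μ k * (p k).toReal) y := by
    have := ENNReal.hasSum_toReal (f := fun k => ENNReal.ofReal (μ k) * p k) (by simp [← h])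
    rw [← ENNReal.tsum_toReal_eq (fun k => ENNReal.mul_ne_top ENNReal.ofReal_ne_top (hpt k)), ← h,
      ENNReal.toReal_ofReal hy.le] at this
    simpa [ENNReal.toReal_ofReal (h0 _)] using this
  -- Averaging the tangent line at the mean y returns its value at y.
  have hg := (hq.mul_left y).sub (hr.mul_left (1 + Real.log y))
  have hval : y * 1 - (1 + Real.log y) * y = Real.negMulLog y := by
    rw [Real.negMulLog]; ring
  rw [hval] at hg
  have hle : ∀ k, Real.negMulLog (μ k) * (p k).toReal ≤
      y * (p k).toReal - (1 + Real.log y) * (μ k * (p k).toReal) := fun k => by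
    refine (mul_le_mul_of_nonneg_right (negMulLog_le_tangent (h0 k) hy)
      ENNReal.toReal_nonneg).trans_eq ?_
    ring
  have hnn : ∀ k, 0 ≤ Real.negMulLog (μ k) * (p k).toReal := fun k =>
    mul_nonneg (Real.negMulLog_nonneg (h0 k) (h1 k)) ENNReal.toReal_nonneg
  rw [← hg.tsum_eq, ENNReal.ofReal_tsum_of_nonneg (fun k => (hnn k).trans (hle k)) hg.summable]
  refine ENNReal.tsum_le_tsum fun k => ?_
  rw [← ENNReal.ofReal_toReal (hpt k), ← ENNReal.ofReal_mul (Real.negMulLog_nonneg (h0 k) (h1 k)),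
    ENNReal.toReal_ofReal ENNReal.toReal_nonneg]
  exact ENNReal.ofReal_le_ofReal (hle k)

theorem differentialEntropy_eq_lintegral {X : Type*} [MeasureSpace X] {f : X → ℝ}
    (h0 : ∀ x, 0 ≤ f x) (h1 : ∀ x, f x ≤ 1) :
    differentialEntropy f = ((∫⁻ x, ENNReal.ofReal (Real.negMulLog (f x)) : ℝ≥0∞) : EReal) := by
  have h : ∀ x, ENNReal.ofReal (f x * Real.log (f x)) = 0 := fun x =>
    ENNReal.ofReal_eq_zero.2 (mul_nonpos_of_nonneg_of_nonpos (h0 x)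
      (Real.log_nonpos (h0 x) (h1 x)))
  simp [differentialEntropy, h, Real.negMulLog]

/-! ### Translated operators and the Berezin–Lieb inequality -/

section Shift

variable {d : ℕ} {S T : L2 d →L[ℂ] L2 d}

instance : SecondCountableTopology (L2 d) :=
  haveI : Fact ((2 : ℝ≥0∞) ≠ ∞) := ⟨ENNReal.ofNat_ne_top⟩
  Lp.SecondCountableTopology

theorem shift_isPositive (hS : S.IsPositive) (z : Phase d) : (shift z S).IsPositive :=
  hS.conj_adjoint _

theorem posTrace_shift (hS : S.IsPositive) (z : Phase d) : posTrace (shift z S) = posTrace S :=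
  posTrace_conj_isometry hS (tfShift z)

theorem norm_shift_le (S : L2 d →L[ℂ] L2 d) (z : Phase d) : ‖shift z S‖ ≤ ‖S‖ := by
  have h : ‖(tfShift z).toContinuousLinearMap‖ ≤ 1 := LinearIsometry.norm_toContinuousLinearMap_le _
  have h' : ‖ContinuousLinearMap.adjoint (tfShift z).toContinuousLinearMap‖ ≤ 1 := by
    rwa [LinearIsometryEquiv.norm_map]
  calc ‖shift z S‖ ≤ ‖(tfShift z).toContinuousLinearMap‖ *
        (‖S‖ * ‖ContinuousLinearMap.adjoint (tfShift z).toContinuousLinearMap‖) :=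
        (ContinuousLinearMap.opNorm_comp_le _ _).trans
          (mul_le_mul_of_nonneg_left (ContinuousLinearMap.opNorm_comp_le _ _) (norm_nonneg _))
    _ ≤ 1 * (‖S‖ * 1) := by gcongr
    _ = ‖S‖ := by ring

/-- The two reflections in S̃ = S ⋆ Š cancel, leaving S̃(z) = tr(S α_z(S)). -/
theorem check_check (S : L2 d →L[ℂ] L2 d) : check (check S) = S := by
  have h : ∀ f : L2 d, reflection (reflection f) = f := fun f => by
    have hp := Measure.measurePreserving_neg (volume : Measure (Space d))
    refine Lp.ext ?_
    filter_upwards [Lp.coeFn_compMeasurePreserving (reflection f) hp,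
      hp.quasiMeasurePreserving.ae (Lp.coeFn_compMeasurePreserving f hp)] with x h1 h2
    refine h1.trans (h2.trans ?_)
    simp
  ext1 f
  simp [check, h]

section Eigenbasis

variable {ι κ : Type*} {b : HilbertBasis ι ℂ (L2 d)} {m : ι → ℝ}
  {c : HilbertBasis κ ℂ (L2 d)} {μ : κ → ℝ}

theorem ofReal_re_inner_shift (hm : ∀ i, 0 ≤ m i) (hs : Summable m)
    (hb : ∀ i, S (b i) = (m i : ℂ) • b i) (z : Phase d) (t : L2 d) :
    ENNReal.ofReal (⟪t, shift z S t⟫_ℂ).re =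
      ∑' i, ENNReal.ofReal (m i) * ‖⟪tfShift z (b i), t⟫_ℂ‖ₑ ^ 2 := by
  set W := ContinuousLinearMap.adjoint (tfShift z).toContinuousLinearMap with hW
  have h : ⟪t, shift z S t⟫_ℂ = ⟪W t, S (W t)⟫_ℂ := by
    rw [hW, ContinuousLinearMap.adjoint_inner_left]; rfl
  rw [h, ofReal_re_inner_apply hm hs hb]
  refine tsum_congr fun i => ?_
  rw [ofReal_norm_sq, hW, ContinuousLinearMap.adjoint_inner_right]
  rfl

/-- Continuity is in operator norm, as the Bochner integral defining w ⋆ S needs. Each rank one term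
is norm continuous, and the summable eigenvalues dominate the series uniformly in z. -/
theorem continuous_shift (hS : S.IsPositive) (h : posTrace S ≠ ∞) :
    Continuous fun z : Phase d => shift z S := by
  obtain ⟨ι, b, m, hm, hb⟩ := exists_hilbertBasis_eigenvectors hS h
  have hs := summable_eigenvalues hS h hm hb
  have heq : ∀ z : Phase d, shift z S =
      ∑' i, (m i : ℂ) • InnerProductSpace.rankOne ℂ (tfShift z (b i)) (tfShift z (b i)) := by
    intro z
    have h1 := (hasSum_rankOne hm hs hb).mapL
      ((ContinuousLinearMap.compL ℂ (L2 d) (L2 d) (L2 d) (tfShift z).toContinuousLinearMap) ∘L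
      ((ContinuousLinearMap.compL ℂ (L2 d) (L2 d) (L2 d)).flip
        (ContinuousLinearMap.adjoint (tfShift z).toContinuousLinearMap)))
    refine h1.tsum_eq.symm.trans (tsum_congr fun i => ?_)
    ext1 x
    simp [ContinuousLinearMap.adjoint_inner_right, -Complex.coe_smul]
  rw [funext heq]
  refine continuous_tsum (fun i => ?_) hs fun i z => ?_
  · have hc := continuous_tfShift (d := d) (b i)
    exact ((ContinuousLinearMap.smulRightL ℂ (L2 d) (L2 d)).continuous₂.comp
      (((innerSL ℂ).continuous.comp hc).prodMk hc)).const_smul (m i : ℂ)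
  · simp [norm_smul, -Complex.coe_smul, b.orthonormal.1, abs_of_nonneg (hm _)]

theorem measurable_ofReal_re_inner_shift (hS : S.IsPositive) (h : posTrace S ≠ ∞) (t : L2 d) :
    Measurable fun z : Phase d => ENNReal.ofReal (⟪t, shift z S t⟫_ℂ).re := by
  have := continuous_shift hS h
  have h2 : Continuous fun z : Phase d => ⟪t, shift z S t⟫_ℂ :=
    continuous_const.inner (this.clm_apply continuous_const)
  exact (Complex.continuous_re.comp h2).measurable.ennreal_ofReal

/-- Expanding S in its eigenbasis reduces this to Moyal's identity term by term. For tr S = 1 and a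
unit vector t the integrand is a probability density on phase space. -/
theorem lintegral_ofReal_re_inner_shift (hS : S.IsPositive) (h : posTrace S ≠ ∞) (t : L2 d) :
    ∫⁻ z : Phase d, ENNReal.ofReal (⟪t, shift z S t⟫_ℂ).re = posTrace S * ‖t‖ₑ ^ 2 := by
  obtain ⟨ι, b, m, hm, hb⟩ := exists_hilbertBasis_eigenvectors hS h
  have hs := summable_eigenvalues hS h hm hb
  have : Countable ι := countable_of_orthonormal b.orthonormal
  have hmeas : ∀ i, Measurable fun z : Phase d => ‖⟪tfShift z (b i), t⟫_ℂ‖ₑ ^ 2 := fun i =>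
    ((continuous_tfShift (b i)).inner continuous_const).measurable.enorm.pow_const 2
  simp only [ofReal_re_inner_shift hm hs hb]
  rw [lintegral_tsum fun i => ((hmeas i).const_mul _).aemeasurable,
    posTrace_eq_tsum_eigenvalues hS hb, ← ENNReal.tsum_mul_right]
  refine tsum_congr fun i => ?_
  rw [lintegral_const_mul _ (hmeas i), lintegral_enorm_inner_tfShift_sq, ← ofReal_norm (b i),
    b.orthonormal.1]
  simp

/-- The Berezin–Lieb inequality for the entropies, for a function `f` given as the
convolution of two density operators. -/
theorem vonNeumannEntropy_le_lintegral (hT : IsDensityOperator T) (hS : IsDensityOperator S)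
    (hμ : ∀ k, 0 ≤ μ k) (hc : ∀ k, T (c k) = (μ k : ℂ) • c k) {f : Phase d → ℝ}
    (hf : ∀ z, 0 ≤ f z) (hfc : ∀ z, ENNReal.ofReal (f z) =
      ∑' k, ENNReal.ofReal (μ k) * ENNReal.ofReal (⟪c k, shift z S (c k)⟫_ℂ).re) :
    vonNeumannEntropy T ≤ ∫⁻ z, ENNReal.ofReal (Real.negMulLog (f z)) := by
  have : Countable κ := countable_of_orthonormal c.orthonormal
  have hSf : posTrace S ≠ ∞ := by simp [hS.2]
  have hμ1 : ∀ k, μ k ≤ 1 := fun k => by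
    have h := posTrace_eq_tsum_eigenvalues hT.1 hc
    rw [hT.2] at h
    rw [← ENNReal.ofReal_le_one, h]
    exact ENNReal.le_tsum k
  rw [vonNeumannEntropy_eq_tsum hT.1 hT.2.le hc]
  calc ∑' k, ENNReal.ofReal (Real.negMulLog (μ k))
      = ∑' k, ∫⁻ z, ENNReal.ofReal (Real.negMulLog (μ k)) *
          ENNReal.ofReal (⟪c k, shift z S (c k)⟫_ℂ).re := by
        refine tsum_congr fun k => ?_
        rw [lintegral_const_mul _ (measurable_ofReal_re_inner_shift hS.1 hSf _),
          lintegral_ofReal_re_inner_shift hS.1 hSf, hS.2, ← ofReal_norm (c k), c.orthonormal.1]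
        simp
    _ = ∫⁻ z, ∑' k, ENNReal.ofReal (Real.negMulLog (μ k)) *
          ENNReal.ofReal (⟪c k, shift z S (c k)⟫_ℂ).re :=
        (lintegral_tsum fun k => ((measurable_ofReal_re_inner_shift hS.1 hSf _).const_mul
          _).aemeasurable).symm
    _ ≤ _ := by
        -- Jensen at fixed z: the weights sum to tr α_z(S) = tr S = 1.
        refine lintegral_mono fun z => tsum_negMulLog_le ?_ hμ hμ1 (hf z) (hfc z)
        rw [← posTrace_eq_of_hilbertBasis c (shift_isPositive hS.1 z), posTrace_shift hS.1, hS.2]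

end Eigenbasis
end Shift

/-! ### The convolution w ⋆ S as a density operator -/

section FunConv

theorem re_inner_shift_nonneg {d : ℕ} {S : L2 d →L[ℂ] L2 d} (hS : S.IsPositive) (z : Phase d)
    (x : L2 d) : 0 ≤ (⟪x, shift z S x⟫_ℂ).re :=
  (shift_isPositive hS z).re_inner_nonneg_right x

variable {d : ℕ} {S : L2 d →L[ℂ] L2 d} {w : Phase d → ℝ}

theorem integrable_smul_shift (hS : S.IsPositive) (h : posTrace S ≠ ∞) (hw : Integrable w) :
    Integrable fun z => (w z : ℂ) • shift z S := by
  have hi := hw.ofReal (𝕜 := ℂ)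
  exact hi.smul_bdd ‖S‖ (continuous_shift hS h).aestronglyMeasurable
    (Eventually.of_forall fun z => norm_shift_le S z)

theorem inner_funConv (hS : S.IsPositive) (h : posTrace S ≠ ∞) (hw : Integrable w) (x y : L2 d) :
    ⟪x, funConv (fun z => (w z : ℂ)) S y⟫_ℂ = ∫ z, (w z : ℂ) * ⟪x, shift z S y⟫_ℂ := by
  have hi := (integrable_smul_shift hS h hw)
  have := (innerSL ℂ x ∘L ContinuousLinearMap.apply ℂ (L2 d) y).integral_comp_comm hi
  simp only [funConv]
  refine Eq.trans ?_ (this.symm.trans ?_)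
  · rfl
  · refine integral_congr_ae (Eventually.of_forall fun z => ?_)
    simp [-Complex.coe_smul]

theorem re_inner_funConv (hS : S.IsPositive) (h : posTrace S ≠ ∞) (hw : Integrable w) (x : L2 d) :
    (⟪x, funConv (fun z => (w z : ℂ)) S x⟫_ℂ).re = ∫ z, w z * (⟪x, shift z S x⟫_ℂ).re := by
  have hi := (innerSL ℂ x ∘L ContinuousLinearMap.apply ℂ (L2 d) x).integrable_comp
    (integrable_smul_shift hS h hw)
  have hi' : Integrable fun z => (w z : ℂ) * ⟪x, shift z S x⟫_ℂ := by
    refine hi.congr (Eventually.of_forall fun z => ?_)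
    simp [-Complex.coe_smul]
  rw [inner_funConv hS h hw]
  refine (Complex.reCLM.integral_comp_comm hi').symm.trans ?_
  simp

theorem ofReal_re_inner_funConv (hS : S.IsPositive) (h : posTrace S ≠ ∞) (hw : Integrable w)
    (hw0 : ∀ z, 0 ≤ w z) (x : L2 d) :
    ENNReal.ofReal (⟪x, funConv (fun z => (w z : ℂ)) S x⟫_ℂ).re =
      ∫⁻ z, ENNReal.ofReal (w z) * ENNReal.ofReal (⟪x, shift z S x⟫_ℂ).re := by
  have hc : Continuous fun z : Phase d => (⟪x, shift z S x⟫_ℂ).re := Complex.continuous_re.comp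
    (continuous_const.inner ((continuous_shift hS h).clm_apply continuous_const))
  have hi : Integrable fun z => w z * (⟪x, shift z S x⟫_ℂ).re := by
    refine hw.mul_bdd (c := ‖x‖ * (‖S‖ * ‖x‖)) hc.aestronglyMeasurable
      (Eventually.of_forall fun z => ?_)
    refine (Complex.abs_re_le_norm _).trans ((norm_inner_le_norm _ _).trans ?_)
    gcongr
    exact (ContinuousLinearMap.le_opNorm _ _).trans (by gcongr; exact norm_shift_le S z)
  rw [re_inner_funConv hS h hw, ofReal_integral_eq_lintegral_ofReal hi
    (Eventually.of_forall fun z => mul_nonneg (hw0 z) (re_inner_shift_nonneg hS z x))]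
  exact lintegral_congr fun z => ENNReal.ofReal_mul (hw0 z)

theorem funConv_isPositive (hS : S.IsPositive) (h : posTrace S ≠ ∞) (hw : Integrable w)
    (hw0 : ∀ z, 0 ≤ w z) : (funConv (fun z => (w z : ℂ)) S).IsPositive := by
  rw [ContinuousLinearMap.isPositive_def]
  refine ⟨fun x y => ?_, fun x => ?_⟩
  · rw [ContinuousLinearMap.coe_coe, inner_funConv hS h hw, ← inner_conj_symm,
      inner_funConv hS h hw, ← integral_conj]
    refine integral_congr_ae (Eventually.of_forall fun z => ?_)
    simp only [map_mul, Complex.conj_ofReal, inner_conj_symm]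
    rw [(shift_isPositive hS z).isSymmetric.apply_clm]
  · rw [ContinuousLinearMap.reApplyInnerSelf_apply, ← inner_re_symm]
    refine (integral_nonneg fun z => ?_).trans_eq (re_inner_funConv hS h hw x).symm
    exact mul_nonneg (hw0 z) (re_inner_shift_nonneg hS z x)

/-- By Tonelli the trace is the w-average of the traces of the α_z(S), all equal to 1. -/
theorem funConv_isDensityOperator (hS : IsDensityOperator S) (hw : Integrable w)
    (hw0 : ∀ z, 0 ≤ w z) (hw1 : ∫⁻ z, ENNReal.ofReal (w z) = 1) :
    IsDensityOperator (funConv (fun z => (w z : ℂ)) S) := by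
  have h : posTrace S ≠ ∞ := by simp [hS.2]
  have : Countable (basisIndex (L2 d)) := countable_of_orthonormal (basis (L2 d)).orthonormal
  refine ⟨funConv_isPositive hS.1 h hw hw0, ?_⟩
  have hwm : AEMeasurable fun z => ENNReal.ofReal (w z) := hw.1.aemeasurable.ennreal_ofReal
  simp only [posTrace, ofReal_re_inner_funConv hS.1 h hw hw0]
  have hme : ∀ i, AEMeasurable fun z => ENNReal.ofReal (w z) *
      ENNReal.ofReal (⟪basis (L2 d) i, shift z S (basis (L2 d) i)⟫_ℂ).re := fun i =>
    hwm.mul (measurable_ofReal_re_inner_shift hS.1 h (basis (L2 d) i)).aemeasurable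
  rw [← lintegral_tsum hme, ← hw1]
  refine lintegral_congr fun z => ?_
  rw [ENNReal.tsum_mul_left]
  change _ * posTrace (shift z S) = _
  rw [posTrace_shift hS.1, hS.2, mul_one]

end FunConv

/-! ### Total correlation, convolutions and the entropy bounds -/

section TotalCorrelation

variable {d : ℕ} {S : L2 d →L[ℂ] L2 d} {w : Phase d → ℝ} {ι κ : Type*}
  {b : HilbertBasis ι ℂ (L2 d)} {m : ι → ℝ} {c : HilbertBasis κ ℂ (L2 d)} {μ : κ → ℝ}

theorem hasSum_totalCorrelation (hm : ∀ i, 0 ≤ m i) (hs : Summable m)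
    (hb : ∀ i, S (b i) = (m i : ℂ) • b i) (z : Phase d) :
    HasSum (fun i => m i * (⟪b i, shift z S (b i)⟫_ℂ).re) (totalCorrelation S z) := by
  have h := (hasSum_trace_comp hm hs hb (shift z S)).mapL Complex.reCLM
  rw [totalCorrelation, opConv, check_check]
  simpa using h

theorem ofReal_totalCorrelation (hS : S.IsPositive) (hm : ∀ i, 0 ≤ m i) (hs : Summable m)
    (hb : ∀ i, S (b i) = (m i : ℂ) • b i) (z : Phase d) :
    ENNReal.ofReal (totalCorrelation S z) =
      ∑' i, ENNReal.ofReal (m i) * ENNReal.ofReal (⟪b i, shift z S (b i)⟫_ℂ).re := by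
  have h := hasSum_totalCorrelation hm hs hb z
  rw [← h.tsum_eq, ENNReal.ofReal_tsum_of_nonneg (fun i => mul_nonneg (hm i)
    (re_inner_shift_nonneg hS z _)) h.summable]
  exact tsum_congr fun i => ENNReal.ofReal_mul (hm i)

theorem totalCorrelation_nonneg (hS : IsDensityOperator S) (z : Phase d) :
    0 ≤ totalCorrelation S z := by
  have h : posTrace S ≠ ∞ := by simp [hS.2]
  obtain ⟨ι, b, m, hm, hb⟩ := exists_hilbertBasis_eigenvectors hS.1 h
  exact (hasSum_totalCorrelation hm (summable_eigenvalues hS.1 h hm hb) hb z).nonneg fun i =>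
    mul_nonneg (hm i) (re_inner_shift_nonneg hS.1 z _)

/-- S̃(z) averages diagonal entries of α_z(S) with the eigenvalues as weights, and each entry is at
most the trace 1. -/
theorem totalCorrelation_le_one (hS : IsDensityOperator S) (z : Phase d) :
    totalCorrelation S z ≤ 1 := by
  have h : posTrace S ≠ ∞ := by simp [hS.2]
  obtain ⟨ι, b, m, hm, hb⟩ := exists_hilbertBasis_eigenvectors hS.1 h
  have hs := summable_eigenvalues hS.1 h hm hb
  rw [← ENNReal.ofReal_le_one, ofReal_totalCorrelation hS.1 hm hs hb, ← hS.2,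
    posTrace_eq_tsum_eigenvalues hS.1 hb]
  refine ENNReal.tsum_le_tsum fun i => mul_le_of_le_one_right' ?_
  refine (ofReal_re_inner_le_posTrace_mul (shift_isPositive hS.1 z) (b i)).trans ?_
  rw [posTrace_shift hS.1, hS.2, b.orthonormal.1]
  simp

theorem measurable_totalCorrelation (hS : IsDensityOperator S) :
    Measurable (totalCorrelation S) := by
  have h : posTrace S ≠ ∞ := by simp [hS.2]
  obtain ⟨ι, b, m, hm, hb⟩ := exists_hilbertBasis_eigenvectors hS.1 h
  have hs := summable_eigenvalues hS.1 h hm hb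
  have : Countable ι := countable_of_orthonormal b.orthonormal
  have heq : totalCorrelation S = fun z => (∑' i, ENNReal.ofReal (m i) *
      ENNReal.ofReal (⟪b i, shift z S (b i)⟫_ℂ).re).toReal := funext fun z => by
    rw [← ofReal_totalCorrelation hS.1 hm hs hb,
      ENNReal.toReal_ofReal (totalCorrelation_nonneg hS z)]
  rw [heq]
  exact (Measurable.tsum fun i =>
    (measurable_ofReal_re_inner_shift hS.1 h (b i)).const_mul _).ennreal_toReal

/-- Phases in the Weyl relation drop out of |⟨π(v) b_j, π(z) b_i⟩|². The double sum is symmetric in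
its weights, so exchanging the indices replaces inverting a shift. -/
theorem ofReal_totalCorrelation_sub (hS : S.IsPositive) (hm : ∀ i, 0 ≤ m i) (hs : Summable m)
    (hb : ∀ i, S (b i) = (m i : ℂ) • b i) (z v : Phase d) :
    ENNReal.ofReal (totalCorrelation S (z - v)) = ∑' i, ENNReal.ofReal (m i) *
      ENNReal.ofReal (⟪tfShift z (b i), shift v S (tfShift z (b i))⟫_ℂ).re := by
  rw [ofReal_totalCorrelation hS hm hs hb]
  simp only [ofReal_re_inner_shift hm hs hb, ← ENNReal.tsum_mul_left]
  rw [ENNReal.tsum_comm]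
  refine tsum_congr fun i => tsum_congr fun j => ?_
  rw [mul_left_comm, ← ofReal_norm ⟪tfShift v (b j), _⟫_ℂ, norm_inner_tfShift_tfShift,
    norm_inner_symm, ofReal_norm]

/-- The convolution `w ∗ S̃`, expanded in an eigenbasis of `w ⋆ S`. -/
theorem ofReal_convolution_totalCorrelation (hS : IsDensityOperator S) (hw : Integrable w)
    (hw0 : ∀ z, 0 ≤ w z) (hμ : ∀ k, 0 ≤ μ k) (hμs : Summable μ)
    (hc : ∀ k, funConv (fun z => (w z : ℂ)) S (c k) = (μ k : ℂ) • c k) (z : Phase d) :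
    ENNReal.ofReal (convolution w (totalCorrelation S) (ContinuousLinearMap.mul ℝ ℝ) volume z) =
      ∑' k, ENNReal.ofReal (μ k) * ENNReal.ofReal (⟪c k, shift z S (c k)⟫_ℂ).re := by
  have h : posTrace S ≠ ∞ := by simp [hS.2]
  obtain ⟨ι, b, m, hm, hb⟩ := exists_hilbertBasis_eigenvectors hS.1 h
  have hs := summable_eigenvalues hS.1 h hm hb
  have : Countable ι := countable_of_orthonormal b.orthonormal
  have hwm : AEMeasurable fun z => ENNReal.ofReal (w z) := hw.1.aemeasurable.ennreal_ofReal
  have hi : Integrable fun v => w v * totalCorrelation S (z - v) := by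
    refine hw.mul_bdd (c := 1) ((measurable_totalCorrelation hS).comp
      (measurable_const.sub measurable_id)).aestronglyMeasurable (Eventually.of_forall fun v => ?_)
    rw [Real.norm_of_nonneg (totalCorrelation_nonneg hS _)]
    exact totalCorrelation_le_one hS _
  simp only [convolution, ContinuousLinearMap.mul_apply']
  rw [ofReal_integral_eq_lintegral_ofReal hi (Eventually.of_forall fun v =>
    mul_nonneg (hw0 v) (totalCorrelation_nonneg hS _))]
  calc ∫⁻ v, ENNReal.ofReal (w v * totalCorrelation S (z - v))
      = ∫⁻ v, ∑' i, ENNReal.ofReal (m i) * (ENNReal.ofReal (w v) *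
          ENNReal.ofReal (⟪tfShift z (b i), shift v S (tfShift z (b i))⟫_ℂ).re) := by
        refine lintegral_congr fun v => ?_
        rw [ENNReal.ofReal_mul (hw0 v), ofReal_totalCorrelation_sub hS.1 hm hs hb,
          ← ENNReal.tsum_mul_left]
        exact tsum_congr fun i => mul_left_comm _ _ _
    _ = ∑' i, ENNReal.ofReal (m i) * ENNReal.ofReal (⟪tfShift z (b i),
          funConv (fun z => (w z : ℂ)) S (tfShift z (b i))⟫_ℂ).re := by
        have hme : ∀ i, AEMeasurable fun v => ENNReal.ofReal (w v) *
            ENNReal.ofReal (⟪tfShift z (b i), shift v S (tfShift z (b i))⟫_ℂ).re := fun i =>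
          hwm.mul (measurable_ofReal_re_inner_shift hS.1 h _).aemeasurable
        rw [lintegral_tsum fun i => (hme i).const_mul _]
        refine tsum_congr fun i => ?_
        rw [lintegral_const_mul'' _ (hme i), ofReal_re_inner_funConv hS.1 h hw hw0]
    -- Both sides are ∑ m_i μ_k |⟨c_k, π(z) b_i⟩|², summed in different orders.
    _ = ∑' k, ENNReal.ofReal (μ k) * ENNReal.ofReal (⟪c k, shift z S (c k)⟫_ℂ).re := by
        simp only [ofReal_re_inner_apply hμ hμs hc, ofReal_re_inner_shift hm hs hb,
          ← ENNReal.tsum_mul_left]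
        rw [ENNReal.tsum_comm]
        refine tsum_congr fun k => tsum_congr fun i => ?_
        rw [mul_left_comm, ofReal_norm_sq, ← ofReal_norm, norm_inner_symm, ofReal_norm]

theorem convolution_totalCorrelation_nonneg (hS : IsDensityOperator S) (hw0 : ∀ z, 0 ≤ w z)
    (z : Phase d) :
    0 ≤ convolution w (totalCorrelation S) (ContinuousLinearMap.mul ℝ ℝ) volume z :=
  integral_nonneg fun v => mul_nonneg (hw0 v) (totalCorrelation_nonneg hS _)

theorem convolution_totalCorrelation_le_one (hS : IsDensityOperator S) (hw : Integrable w)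
    (hw0 : ∀ z, 0 ≤ w z) (hw1 : ∫⁻ z, ENNReal.ofReal (w z) = 1) (z : Phase d) :
    convolution w (totalCorrelation S) (ContinuousLinearMap.mul ℝ ℝ) volume z ≤ 1 := by
  have h1 : ∫ v, w v = 1 := by
    rw [integral_eq_lintegral_of_nonneg_ae (Eventually.of_forall hw0) hw.1, hw1, ENNReal.toReal_one]
  rw [← h1]
  refine integral_mono_of_nonneg (Eventually.of_forall fun v =>
    mul_nonneg (hw0 v) (totalCorrelation_nonneg hS _)) hw (Eventually.of_forall fun v => ?_)
  exact mul_le_of_le_one_right (hw0 v) (totalCorrelation_le_one hS _)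

theorem vonNeumannEntropy_funConv_le (hS : IsDensityOperator S) (hw : Integrable w)
    (hw0 : ∀ z, 0 ≤ w z) (hw1 : ∫⁻ z, ENNReal.ofReal (w z) = 1) :
    (vonNeumannEntropy (funConv (fun z => (w z : ℂ)) S) : EReal) ≤ differentialEntropy
      (convolution w (totalCorrelation S) (ContinuousLinearMap.mul ℝ ℝ) volume) := by
  have hT := funConv_isDensityOperator hS hw hw0 hw1
  have hTf : posTrace (funConv (fun z => (w z : ℂ)) S) ≠ ∞ := by simp [hT.2]
  obtain ⟨κ, c, μ, hμ, hc⟩ := exists_hilbertBasis_eigenvectors hT.1 hTf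
  rw [differentialEntropy_eq_lintegral (convolution_totalCorrelation_nonneg hS hw0)
    (convolution_totalCorrelation_le_one hS hw hw0 hw1), EReal.coe_ennreal_le_coe_ennreal_iff]
  exact vonNeumannEntropy_le_lintegral hT hS hμ hc (convolution_totalCorrelation_nonneg hS hw0)
    (ofReal_convolution_totalCorrelation hS hw hw0 hμ (summable_eigenvalues hT.1 hTf hμ hc) hc)

theorem vonNeumannEntropy_le_totalCorrelation (hS : IsDensityOperator S) :
    (vonNeumannEntropy S : EReal) ≤ differentialEntropy (totalCorrelation S) := by
  have h : posTrace S ≠ ∞ := by simp [hS.2]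
  obtain ⟨ι, b, m, hm, hb⟩ := exists_hilbertBasis_eigenvectors hS.1 h
  rw [differentialEntropy_eq_lintegral (totalCorrelation_nonneg hS) (totalCorrelation_le_one hS),
    EReal.coe_ennreal_le_coe_ennreal_iff]
  exact vonNeumannEntropy_le_lintegral hS hS hm hb (totalCorrelation_nonneg hS)
    (ofReal_totalCorrelation hS.1 hm (summable_eigenvalues hS.1 h hm hb) hb)

/-- A lower bound for the entropy of `w ⋆ S` when the density `w` is bounded by `C⁻¹`. -/
theorem log_le_vonNeumannEntropy_funConv (hS : IsDensityOperator S) (hw : Integrable w)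
    (hw0 : ∀ z, 0 ≤ w z) (hw1 : ∫⁻ z, ENNReal.ofReal (w z) = 1) {C : ℝ} (hC : 0 < C)
    (hwC : ∀ z, w z ≤ C⁻¹) :
    (Real.log C : EReal) ≤ (vonNeumannEntropy (funConv (fun z => (w z : ℂ)) S) : EReal) := by
  have hT := funConv_isDensityOperator hS hw hw0 hw1
  have hSf : posTrace S ≠ ∞ := by simp [hS.2]
  obtain ⟨κ, c, μ, hμ, hc⟩ := exists_hilbertBasis_eigenvectors hT.1 (by simp [hT.2])
  -- The eigenvalue μ_k is the integral of w against the probability density p_k.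
  have hμC : ∀ k, μ k ≤ C⁻¹ := fun k => by
    rw [← ENNReal.ofReal_le_ofReal_iff (by positivity)]
    have h1 : (⟪c k, funConv (fun z => (w z : ℂ)) S (c k)⟫_ℂ).re = μ k := by
      rw [hc, inner_smul_right, inner_self_eq_norm_sq_to_K, c.orthonormal.1]
      simp
    rw [← h1, ofReal_re_inner_funConv hS.1 hSf hw hw0]
    calc ∫⁻ z, ENNReal.ofReal (w z) * ENNReal.ofReal (⟪c k, shift z S (c k)⟫_ℂ).re
        ≤ ∫⁻ z, ENNReal.ofReal C⁻¹ * ENNReal.ofReal (⟪c k, shift z S (c k)⟫_ℂ).re :=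
          lintegral_mono fun z => mul_le_mul_left (ENNReal.ofReal_le_ofReal (hwC z)) _
      _ = ENNReal.ofReal C⁻¹ := by
          rw [lintegral_const_mul _ (measurable_ofReal_re_inner_shift hS.1 hSf _),
            lintegral_ofReal_re_inner_shift hS.1 hSf, hS.2, ← ofReal_norm (c k), c.orthonormal.1]
          simp
  have key : ENNReal.ofReal (Real.log C) ≤
      vonNeumannEntropy (funConv (fun z => (w z : ℂ)) S) := by
    rcases le_or_gt (Real.log C) 0 with hl | hl
    · simp [ENNReal.ofReal_eq_zero.2 hl]
    have htr := posTrace_eq_tsum_eigenvalues hT.1 hc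
    -- Writing log C as ∑ μ_k log C reduces the bound to log C ≤ -log μ_k wherever μ_k > 0.
    rw [vonNeumannEntropy_eq_tsum hT.1 hT.2.le hc, ← mul_one (ENNReal.ofReal (Real.log C)), ← hT.2,
      htr, ← ENNReal.tsum_mul_left]
    refine ENNReal.tsum_le_tsum fun k => ?_
    rw [← ENNReal.ofReal_mul hl.le]
    refine ENNReal.ofReal_le_ofReal ?_
    rcases (hμ k).eq_or_lt with h0 | h0
    · simp [← h0]
    have := Real.log_le_log h0 (hμC k)
    rw [Real.log_inv] at this
    rw [Real.negMulLog]
    nlinarith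
  refine le_trans ?_ (EReal.coe_ennreal_le_coe_ennreal_iff.2 key)
  rw [EReal.coe_ennreal_ofReal]
  exact_mod_cast le_max_left _ _

theorem normalizedIndicator_nonneg (Ω : Set (Phase d)) (z : Phase d) :
    0 ≤ normalizedIndicator Ω z :=
  Set.indicator_nonneg (fun _ _ => inv_nonneg.2 measureReal_nonneg) z

theorem normalizedIndicator_le (Ω : Set (Phase d)) (z : Phase d) :
    normalizedIndicator Ω z ≤ (volume.real Ω)⁻¹ :=
  Set.indicator_le_self' (fun _ _ => inv_nonneg.2 measureReal_nonneg) z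

theorem integrable_normalizedIndicator {Ω : Set (Phase d)} (hΩ : IsCompact Ω) :
    Integrable (normalizedIndicator Ω) :=
  (integrable_indicator_iff hΩ.measurableSet).2
    (integrableOn_const hΩ.measure_lt_top.ne)

theorem lintegral_normalizedIndicator {Ω : Set (Phase d)} (hΩ : IsCompact Ω)
    (h0 : 0 < volume Ω) : ∫⁻ z, ENNReal.ofReal (normalizedIndicator Ω z) = 1 := by
  have h : ∀ z, ENNReal.ofReal (normalizedIndicator Ω z) =
      Ω.indicator (fun _ => (volume Ω)⁻¹) z := fun z => by
    by_cases hz : z ∈ Ω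
    · rw [normalizedIndicator, Set.indicator_of_mem hz, Set.indicator_of_mem hz,
        ENNReal.ofReal_inv_of_pos (by exact ENNReal.toReal_pos h0.ne' hΩ.measure_lt_top.ne),
        ofReal_measureReal hΩ.measure_lt_top.ne]
    · simp [normalizedIndicator, hz]
  simp only [h]
  rw [lintegral_indicator_const hΩ.measurableSet,
    ENNReal.inv_mul_cancel h0.ne' hΩ.measure_lt_top.ne]

end TotalCorrelation
end QHA

theorem mainTheorem3 (d : ℕ) (S : QHA.L2 d →L[ℂ] QHA.L2 d) (hS : QHA.IsDensityOperator S) :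
    (∀ Ω : Set (QHA.Phase d), IsCompact Ω → 0 < MeasureTheory.volume Ω →
      (QHA.vonNeumannEntropy
          (QHA.funConv (fun z => (QHA.normalizedIndicator Ω z : ℂ)) S) : EReal) ≤
        QHA.differentialEntropy
          (MeasureTheory.convolution (QHA.normalizedIndicator Ω) (QHA.totalCorrelation S)
            (ContinuousLinearMap.mul ℝ ℝ) MeasureTheory.volume) ∧
      (Real.log (MeasureTheory.volume.real Ω) : EReal) ≤
        (QHA.vonNeumannEntropy
          (QHA.funConv (fun z => (QHA.normalizedIndicator Ω z : ℂ)) S) : EReal)) ∧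
    (QHA.vonNeumannEntropy S : EReal) ≤ QHA.differentialEntropy (QHA.totalCorrelation S) := by
  refine ⟨fun Ω hΩ h0 => ?_, QHA.vonNeumannEntropy_le_totalCorrelation hS⟩
  have hi := QHA.integrable_normalizedIndicator hΩ
  have h1 := QHA.lintegral_normalizedIndicator hΩ h0
  exact ⟨QHA.vonNeumannEntropy_funConv_le hS hi (QHA.normalizedIndicator_nonneg Ω) h1,
    QHA.log_le_vonNeumannEntropy_funConv hS hi (QHA.normalizedIndicator_nonneg Ω) h1
      (ENNReal.toReal_pos h0.ne' hΩ.measure_lt_top.ne) (QHA.normalizedIndicator_le Ω)⟩
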